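/- Let $W_e^X$ be the $e$-th set computably enumerable in $X\subseteq\omega$, let $W_e=W_e^{\emptyset}$, and fix a computable pairing $\langle\cdot,\cdot\rangle$ of $\omega\times\omega$ with $\omega$. For $C\subseteq\omega$ write $C^{[n]}=\{y:\langle n,y\rangle\in C\}$, $C^{[<n]}=\{\langle m,y\rangle\in C: m<n\}$ and $C^{[\le n]}=\{\langle m,y\rangle\in C: m\le n\}$. Call $C$ an $\mathrm{REA}[\omega]$ set if there is a computable function $f:\omega\to\omega$ with $C^{[n]}=W_{f(n)}^{C^{[<n]}}$ for all $n$. Let $C$ be a non-computable $\mathrm{REA}[\omega]$ set. Then $C$ and $0''$ do not form a minimal pair; that is, there is a non-computable set $B$ with $B\le_T C$ and $B\le_T 0''$ (equivalently, $\mathbf 0$ is not the greatest lower bound of the degrees of $C$ and $0''$). Moreover, at least one of the following holds: 1. there is an $n$ such that $C^{[\le n]}$ is non-computable and $C^{[\le n]}\le_T 0'$ (i.e. $C^{[\le n]}$ is $\Delta^0_2$); 2. there are functions $i,j:\omega\to\omega$ computable from $0''$ such that for every $n$, $C^{[\le n]}=W_{i(n)}$ and $\omega\setminus C^{[\le n]}=W_{j(n)}$;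 and $C\le_T 0''$. -/

import Mathlib

/-- Programs for oracle computations on `ℕ`: the clauses of `Nat.RecursiveIn` for one oracle. -/
inductive OracleCode : Type
  | zero : OracleCode
  | succ : OracleCode
  | left : OracleCode
  | right : OracleCode
  | oracle : OracleCode
  | pair : OracleCode → OracleCode → OracleCode
  | comp : OracleCode → OracleCode → OracleCode
  | prec : OracleCode → OracleCode → OracleCode
  | rfind : OracleCode → OracleCode

namespace OracleCode

/-- The partial function computed by a program with oracle `g`. -/
def eval (g : ℕ →. ℕ) : OracleCode → ℕ →. ℕ
  | zero => fun _ => 0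
  | succ => fun n => Part.some (Nat.succ n)
  | left => fun n => Part.some (Nat.unpair n).1
  | right => fun n => Part.some (Nat.unpair n).2
  | oracle => g
  | pair cf cg => fun n => Nat.pair <$> eval g cf n <*> eval g cg n
  | comp cf cg => fun n => eval g cg n >>= eval g cf
  | prec cf cg => fun p =>
      let (a, n) := Nat.unpair p
      n.rec (eval g cf a) fun y IH => do
        let i ← IH
        eval g cg (Nat.pair a (Nat.pair y i))
  | rfind cf => fun a => Nat.rfind fun n => (fun m => m = 0) <$> eval g cf (Nat.pair a n)

/-- The code number of a program. -/
def encodeCode : OracleCode → ℕ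
  | zero => 0
  | succ => 1
  | left => 2
  | right => 3
  | oracle => 4
  | pair cf cg => 2 * (2 * Nat.pair (encodeCode cf) (encodeCode cg)) + 5
  | comp cf cg => 2 * (2 * Nat.pair (encodeCode cf) (encodeCode cg) + 1) + 5
  | prec cf cg => (2 * (2 * Nat.pair (encodeCode cf) (encodeCode cg)) + 1) + 5
  | rfind cf => (2 * (2 * encodeCode cf + 1) + 1) + 5

/-- The program with a given code number. -/
def ofNatCode : ℕ → OracleCode
  | 0 => zero
  | 1 => succ
  | 2 => left
  | 3 => right
  | 4 => oracle
  | n + 5 =>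
    let m := n.div2.div2
    have hm : m < n + 5 := by
      simp only [m, Nat.div2_val]
      omega
    have _m1 : m.unpair.1 < n + 5 := lt_of_le_of_lt m.unpair_left_le hm
    have _m2 : m.unpair.2 < n + 5 := lt_of_le_of_lt m.unpair_right_le hm
    match n.bodd, n.div2.bodd with
    | false, false => pair (ofNatCode m.unpair.1) (ofNatCode m.unpair.2)
    | false, true => comp (ofNatCode m.unpair.1) (ofNatCode m.unpair.2)
    | true, false => prec (ofNatCode m.unpair.1) (ofNatCode m.unpair.2)
    | true, true => rfind (ofNatCode m)
  decreasing_by all_goals first | exact hm | exact _m1 | exact _m2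

/-- Every program has a code number. -/
theorem ofNatCode_encodeCode (c : OracleCode) : ofNatCode (encodeCode c) = c := by
  induction c <;> simp [encodeCode, ofNatCode, Nat.div2_val, *]

/-- The programs with oracle `g` compute exactly the partial functions recursive in `g`. -/
theorem exists_code {g f : ℕ →. ℕ} : Nat.RecursiveIn {g} f ↔ ∃ c : OracleCode, eval g c = f := by
  constructor
  · intro h
    induction h with
    | zero => exact ⟨zero, rfl⟩
    | succ => exact ⟨succ, rfl⟩
    | left => exact ⟨left, rfl⟩
    | right => exact ⟨right, rfl⟩
    | oracle k hk => exact ⟨oracle, (Set.mem_singleton_iff.1 hk).symm⟩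
    | pair _ _ h1 h2 =>
      obtain ⟨c, rfl⟩ := h1
      obtain ⟨d, rfl⟩ := h2
      exact ⟨pair c d, rfl⟩
    | comp _ _ h1 h2 =>
      obtain ⟨c, rfl⟩ := h1
      obtain ⟨d, rfl⟩ := h2
      exact ⟨comp c d, rfl⟩
    | prec _ _ h1 h2 =>
      obtain ⟨c, rfl⟩ := h1
      obtain ⟨d, rfl⟩ := h2
      exact ⟨prec c d, rfl⟩
    | rfind _ h1 =>
      obtain ⟨c, rfl⟩ := h1
      exact ⟨rfind c, rfl⟩
  · rintro ⟨c, rfl⟩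
    induction c with
    | zero => exact .zero
    | succ => exact .succ
    | left => exact .left
    | right => exact .right
    | oracle => exact .oracle g rfl
    | pair _ _ h1 h2 => exact .pair h1 h2
    | comp _ _ h1 h2 => exact .comp h1 h2
    | prec _ _ h1 h2 => exact .prec h1 h2
    | rfind _ h1 => exact .rfind h1

end OracleCode

open Classical in
/-- The characteristic function of a set of natural numbers, as an oracle. -/
noncomputable def charFn (X : Set ℕ) : ℕ →. ℕ :=
  fun n => Part.some (if n ∈ X then 1 else 0)

/-- Turing reducibility of sets of natural numbers. -/
def SetTuringReducible (A B : Set ℕ) : Prop :=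
  TuringReducible (charFn A) (charFn B)

/-- A set of natural numbers is computable. -/
def IsComputableSet (A : Set ℕ) : Prop :=
  ComputablePred fun x => x ∈ A

/-- `relCE e X` is the `e`-th set computably enumerable in `X`: the domain of the `e`-th partial
functional with oracle `X`. -/
def relCE (e : ℕ) (X : Set ℕ) : Set ℕ :=
  {x | (OracleCode.eval (charFn X) (OracleCode.ofNatCode e) x).Dom}

/-- `ceSet e` is the `e`-th computably enumerable set. -/
def ceSet (e : ℕ) : Set ℕ :=
  relCE e ∅

/-- The Turing jump of a set. -/
def turingJump (X : Set ℕ) : Set ℕ :=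
  {e | e ∈ relCE e X}

/-- The `n`-th column of a set. -/
def column (X : Set ℕ) (n : ℕ) : Set ℕ :=
  {y | Nat.pair n y ∈ X}

/-- The part of a set lying in the columns with index less than `n`. -/
def columnsLT (X : Set ℕ) (n : ℕ) : Set ℕ :=
  {x | x ∈ X ∧ (Nat.unpair x).1 < n}

/-- The part of a set lying in the columns with index at most `n`. -/
def columnsLE (X : Set ℕ) (n : ℕ) : Set ℕ :=
  {x | x ∈ X ∧ (Nat.unpair x).1 ≤ n}

/-- `C` is REA[ω]: the `n`-th column of `C` is, uniformly in `n`, computably enumerable in the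
part of `C` lying in the earlier columns. -/
def IsREAOmega (C : Set ℕ) : Prop :=
  ∃ f : ℕ → ℕ, Computable f ∧ ∀ n, column C n = relCE (f n) (columnsLT C n)

/-- `A` and `B` form a minimal pair: both are non-computable, and every set reducible to both is
computable. -/
def IsMinimalPair (A B : Set ℕ) : Prop :=
  ¬ IsComputableSet A ∧ ¬ IsComputableSet B ∧
    ∀ X : Set ℕ, SetTuringReducible X A → SetTuringReducible X B → IsComputableSet X

/-! Suppose some `columnsLE C n` is non-computable and take the least such `n`. The earlier columns
form a computable set, and the `n`-th column is c.e. in it, hence c.e.; so `columnsLE C n` is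
reducible to `0'`. It is also reducible to `C`, so it witnesses the failure of minimality
(`columnsLE_le_jump`).

Otherwise every initial segment of columns is computable, and `0''` can find programs deciding them
by recursion on `n`. Given a program `d` for the columns below `n`, replacing oracle calls by runs
of `d` (`substIdx`) gives a plain c.e. index for column `n`. That `d'` decides the enlarged set is
then a universal statement over a `0'`-decidable matrix, which `0''` decides (`isNextIndex_le`).
Searching for `d'` succeeds because the enlarged set is computable (`exists_computableIn_index`).
Running the programs found gives `C` reducible to `0''`, so `C` itself is the witness. -/

namespace OracleCode

/-! ### Effective operations on programs: composition, constants, oracle substitution -/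

/-- The code number of the pairing of the programs numbered `a` and `b`. -/
def pairIdx (a b : ℕ) : ℕ := 2 * (2 * Nat.pair a b) + 5

/-- The code number of the composition of the programs numbered `a` and `b`. -/
def compIdx (a b : ℕ) : ℕ := 2 * (2 * Nat.pair a b + 1) + 5

/-- The code number of the primitive recursion given by the programs numbered `a` and `b`. -/
def precIdx (a b : ℕ) : ℕ := (2 * (2 * Nat.pair a b) + 1) + 5

/-- The code number of the unbounded search given by the program numbered `a`. -/
def rfindIdx (a : ℕ) : ℕ := (2 * (2 * a + 1) + 1) + 5

@[simp] theorem ofNatCode_pairIdx (a b : ℕ) :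
    ofNatCode (pairIdx a b) = pair (ofNatCode a) (ofNatCode b) := by
  simp [pairIdx, ofNatCode, Nat.div2_val]

@[simp] theorem ofNatCode_compIdx (a b : ℕ) :
    ofNatCode (compIdx a b) = comp (ofNatCode a) (ofNatCode b) := by
  simp [compIdx, ofNatCode, Nat.div2_val]

@[simp] theorem ofNatCode_precIdx (a b : ℕ) :
    ofNatCode (precIdx a b) = prec (ofNatCode a) (ofNatCode b) := by
  simp [precIdx, ofNatCode, Nat.div2_val]

@[simp] theorem ofNatCode_rfindIdx (a : ℕ) :
    ofNatCode (rfindIdx a) = rfind (ofNatCode a) := by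
  simp [rfindIdx, ofNatCode, Nat.div2_val]

theorem primrec_pairIdx : Primrec₂ pairIdx :=
  Primrec.nat_add.comp₂ (Primrec.nat_mul.comp₂ (Primrec₂.const 2)
    (Primrec.nat_mul.comp₂ (Primrec₂.const 2) Primrec₂.natPair)) (Primrec₂.const 5)

theorem primrec_compIdx : Primrec₂ compIdx :=
  Primrec.nat_add.comp₂ (Primrec.nat_mul.comp₂ (Primrec₂.const 2)
    (Primrec.nat_add.comp₂ (Primrec.nat_mul.comp₂ (Primrec₂.const 2) Primrec₂.natPair)
      (Primrec₂.const 1))) (Primrec₂.const 5)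

theorem primrec_precIdx : Primrec₂ precIdx :=
  Primrec.nat_add.comp₂ (Primrec.nat_add.comp₂ (Primrec.nat_mul.comp₂ (Primrec₂.const 2)
    (Primrec.nat_mul.comp₂ (Primrec₂.const 2) Primrec₂.natPair)) (Primrec₂.const 1))
    (Primrec₂.const 5)

theorem primrec_rfindIdx : Primrec rfindIdx :=
  Primrec.nat_add.comp (Primrec.nat_add.comp (Primrec.nat_mul.comp (Primrec.const 2)
    (Primrec.nat_add.comp (Primrec.nat_mul.comp (Primrec.const 2) Primrec.id)
      (Primrec.const 1))) (Primrec.const 1)) (Primrec.const 5)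

/-- The code number of a program for the constant function with value `n`. -/
def constIdx (n : ℕ) : ℕ := n.rec 0 fun _ k => compIdx 1 k

theorem primrec_constIdx : Primrec constIdx :=
  Primrec.nat_rec₁ 0 (primrec_compIdx.comp₂ (Primrec₂.const 1) Primrec₂.right)

theorem eval_constIdx (g : ℕ →. ℕ) (n x : ℕ) :
    eval g (ofNatCode (constIdx n)) x = Part.some n := by
  induction n with
  | zero => simp [constIdx, ofNatCode, eval]; rfl
  | succ n ih =>
    change eval g (ofNatCode (compIdx 1 (constIdx n))) x = _
    simp [ofNatCode, eval, ih]

/-- The code number of the program numbered `n` with its oracle calls replaced by calls to the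
program numbered `d`. -/
def substIdx (d : ℕ) : ℕ → ℕ
  | 0 => 0
  | 1 => 1
  | 2 => 2
  | 3 => 3
  | 4 => d
  | n + 5 =>
    let m := n.div2.div2
    have hm : m < n + 5 := by
      simp only [m, Nat.div2_val]
      omega
    have _m1 : m.unpair.1 < n + 5 := lt_of_le_of_lt m.unpair_left_le hm
    have _m2 : m.unpair.2 < n + 5 := lt_of_le_of_lt m.unpair_right_le hm
    cond n.bodd
      (cond n.div2.bodd (rfindIdx (substIdx d m))
        (precIdx (substIdx d m.unpair.1) (substIdx d m.unpair.2)))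
      (cond n.div2.bodd (compIdx (substIdx d m.unpair.1) (substIdx d m.unpair.2))
        (pairIdx (substIdx d m.unpair.1) (substIdx d m.unpair.2)))
  decreasing_by all_goals first | exact hm | exact _m1 | exact _m2

/-- An effective form of transitivity of relative computability: the new program depends only on the
two code numbers. -/
theorem eval_substIdx (g : ℕ →. ℕ) (d n : ℕ) :
    eval g (ofNatCode (substIdx d n)) = eval (eval g (ofNatCode d)) (ofNatCode n) := by
  induction n using Nat.strong_induction_on with
  | _ n ih =>
    match n with
    | 0 | 1 | 2 | 3 | 4 => simp [substIdx, ofNatCode, eval] <;> rfl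
    | n + 5 =>
      have hm : n.div2.div2 < n + 5 := by
        simp only [Nat.div2_val]
        omega
      have m1 := ih _ (lt_of_le_of_lt (Nat.unpair_left_le n.div2.div2) hm)
      have m2 := ih _ (lt_of_le_of_lt (Nat.unpair_right_le n.div2.div2) hm)
      have m0 := ih _ hm
      cases h1 : n.bodd <;> cases h2 : n.div2.bodd <;>
        simp [substIdx, ofNatCode, eval, h1, h2, m0, m1, m2] <;> rfl

/-- One step of the course-of-values recursion that computes `substIdx d`. -/
def substStep (d : ℕ) (l : List ℕ) : ℕ :=
  -- The list holds the earlier values, so its length is the argument. The truncated subtraction is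
  -- harmless because lengths below 5 are treated separately.
  let n := l.length - 5
  let m := n.div2.div2
  if l.length < 4 then l.length else if l.length = 4 then d else
    cond n.bodd
      (cond n.div2.bodd (rfindIdx (l.getD m 0))
        (precIdx (l.getD m.unpair.1 0) (l.getD m.unpair.2 0)))
      (cond n.div2.bodd (compIdx (l.getD m.unpair.1 0) (l.getD m.unpair.2 0))
        (pairIdx (l.getD m.unpair.1 0) (l.getD m.unpair.2 0)))

theorem substStep_map_range (d n : ℕ) :
    substStep d ((List.range n).map (substIdx d)) = substIdx d n := by
  match n with
  | 0 | 1 | 2 | 3 | 4 => simp [substIdx, substStep]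
  | n + 5 =>
    have hm : n.div2.div2 < n + 5 := by
      simp only [Nat.div2_val]
      omega
    have m1 := lt_of_le_of_lt (Nat.unpair_left_le n.div2.div2) hm
    have m2 := lt_of_le_of_lt (Nat.unpair_right_le n.div2.div2) hm
    simp [substIdx, substStep, hm, m1, m2, List.getD_eq_getElem?_getD]

theorem primrec_substStep : Primrec₂ substStep := by
  have hl : Primrec fun p : ℕ × List ℕ => p.2.length := Primrec.list_length.comp Primrec.snd
  have hn : Primrec fun p : ℕ × List ℕ => p.2.length - 5 :=
    Primrec.nat_sub.comp hl (Primrec.const 5)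
  have hd : Primrec fun p : ℕ × List ℕ => (p.2.length - 5).div2 := Primrec.nat_div2.comp hn
  have hm : Primrec fun p : ℕ × List ℕ => (p.2.length - 5).div2.div2 := Primrec.nat_div2.comp hd
  have hu := Primrec.unpair.comp hm
  have get {k : ℕ × List ℕ → ℕ} (hk : Primrec k) :
      Primrec fun p : ℕ × List ℕ => p.2.getD (k p) 0 :=
    (Primrec.list_getD 0).comp Primrec.snd hk
  have h0 := get hm
  have h1 := get (Primrec.fst.comp hu)
  have h2 := get (Primrec.snd.comp hu)
  refine Primrec.ite (Primrec.nat_lt.comp hl (Primrec.const 4)) hl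
    (Primrec.ite (Primrec.eq.comp hl (Primrec.const 4)) Primrec.fst ?_)
  have hb := Primrec.nat_bodd.comp hd
  exact Primrec.cond (Primrec.nat_bodd.comp hn)
    (Primrec.cond hb (primrec_rfindIdx.comp h0) (primrec_precIdx.comp h1 h2))
    (Primrec.cond hb (primrec_compIdx.comp h1 h2) (primrec_pairIdx.comp h1 h2))

theorem primrec_substIdx : Primrec₂ substIdx :=
  Primrec.nat_strong_rec substIdx (g := fun d l => some (substStep d l))
    (Primrec.option_some.comp₂ primrec_substStep)
    fun d n => congrArg some (substStep_map_range d n)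

theorem eval_comp_of_eq {g : ℕ →. ℕ} {c d : OracleCode} {x y : ℕ} (h : eval g d x = Part.some y) :
    eval g (comp c d) x = eval g c y := by
  change (eval g d x).bind (eval g c) = _
  rw [h]
  exact Part.bind_some _ _

theorem dom_eval_rfind_of_total {g : ℕ →. ℕ} {c : OracleCode} {f : ℕ → ℕ}
    (h : ∀ n, eval g c n = Part.some (f n)) (a : ℕ) :
    (eval g (rfind c) a).Dom ↔ ∃ n, f (Nat.pair a n) = 0 := by
  refine Nat.rfind_dom.trans ?_
  simp [h]

/-- A search whose body ignores the counter is settled at its first test, so it converts "the value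
is 0" into halting. -/
theorem dom_eval_rfind_of_const {g : ℕ →. ℕ} {c : OracleCode} {h : Part ℕ} {a : ℕ}
    (H : ∀ n, eval g c (Nat.pair a n) = h) : (eval g (rfind c) a).Dom ↔ 0 ∈ h := by
  refine Nat.rfind_dom.trans ?_
  simp only [H]
  constructor
  · rintro ⟨_, h0, -⟩
    simpa using h0
  · intro h0
    refine ⟨0, by simpa using h0, fun {m} hm => absurd hm m.not_lt_zero⟩

end OracleCode

open OracleCode

/-! ### Turing reducibility of sets and quantifiers over the jump -/

/-- Precomposing with a constant program makes the diagonal input irrelevant; this is the many-one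
completeness of the jump. -/
theorem mem_relCE_iff {e x : ℕ} {X : Set ℕ} :
    x ∈ relCE e X ↔ compIdx e (constIdx x) ∈ turingJump X := by
  simp [relCE, turingJump, eval_comp_of_eq (eval_constIdx _ x _)]

theorem computableIn_nat {O : Set (ℕ →. ℕ)} {f : ℕ → ℕ} :
    ComputableIn O f ↔ Nat.RecursiveIn O fun n => Part.some (f n) :=
  RecursiveIn.iff_nat

theorem ComputableIn.natComp {O : Set (ℕ →. ℕ)} {f g : ℕ → ℕ} (hf : ComputableIn O f)
    (hg : ComputableIn O g) : ComputableIn O fun n => f (g n) := by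
  rw [computableIn_nat] at *
  exact (hf.comp hg).of_eq fun n => by simp

theorem ComputableIn.natPair {O : Set (ℕ →. ℕ)} {f g : ℕ → ℕ} (hf : ComputableIn O f)
    (hg : ComputableIn O g) : ComputableIn O fun n => Nat.pair (f n) (g n) := by
  rw [computableIn_nat] at *
  exact (hf.pair hg).of_eq fun n => by simp [Seq.seq]

namespace SetTuringReducible

variable {A B Y : Set ℕ}

theorem refl (X : Set ℕ) : SetTuringReducible X X :=
  TuringReducible.refl _

theorem preimage {f : ℕ → ℕ} (hA : SetTuringReducible A Y) (hf : ComputableIn {charFn Y} f) :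
    SetTuringReducible {x | f x ∈ A} Y := by
  rw [computableIn_nat] at hf
  exact RecursiveIn.iff_nat.2 (((RecursiveIn.iff_nat.1 hA).comp hf).of_eq fun n =>
    (Part.bind_some (f n) (charFn A)).trans (by simp [charFn]))

theorem preimage_primrec {f : ℕ → ℕ} (hA : SetTuringReducible A Y) (hf : Primrec f) :
    SetTuringReducible {x | f x ∈ A} Y :=
  hA.preimage hf.computableIn

theorem of_computable (hA : IsComputableSet A) : SetTuringReducible A Y := by
  classical
  have h : Computable fun x => if x ∈ A then 1 else 0 :=
    (Computable.cond hA.decide (Computable.const 1) (Computable.const 0)).of_eq fun x => by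
      by_cases hx : x ∈ A <;> simp [hx]
  refine RecursiveIn.of_eq (h.computableIn (O := {charFn Y})) fun x => ?_
  by_cases hx : x ∈ A <;> simp [charFn, hx]

theorem of_primrecPred {p : ℕ → Prop} (hp : PrimrecPred p) : SetTuringReducible {x | p x} Y :=
  of_computable hp.computablePred

theorem compl (hA : SetTuringReducible A Y) : SetTuringReducible Aᶜ Y := by
  have h : Nat.RecursiveIn {charFn Y} fun n => Part.some (1 - n) :=
    computableIn_nat.1 (Primrec.nat_sub.comp (Primrec.const 1) Primrec.id).computableIn
  refine RecursiveIn.iff_nat.2 ((h.comp (RecursiveIn.iff_nat.1 hA)).of_eq fun n => ?_)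
  by_cases hx : n ∈ A <;> simp [charFn, hx]

theorem inter (hA : SetTuringReducible A Y) (hB : SetTuringReducible B Y) :
    SetTuringReducible (A ∩ B) Y := by
  have h : Nat.RecursiveIn {charFn Y} fun n => Part.some (n.unpair.1 * n.unpair.2) :=
    computableIn_nat.1 (Primrec.nat_mul.comp (Primrec.fst.comp Primrec.unpair)
      (Primrec.snd.comp Primrec.unpair)).computableIn
  refine RecursiveIn.iff_nat.2
    ((h.comp ((RecursiveIn.iff_nat.1 hA).pair (RecursiveIn.iff_nat.1 hB))).of_eq fun n => ?_)
  by_cases hx : n ∈ A <;> by_cases hy : n ∈ B <;> simp [charFn, hx, hy, Seq.seq]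

theorem union (hA : SetTuringReducible A Y) (hB : SetTuringReducible B Y) :
    SetTuringReducible (A ∪ B) Y := by
  simpa [Set.compl_inter] using (hA.compl.inter hB.compl).compl

theorem relCE_jump (Y : Set ℕ) :
    SetTuringReducible {p | p.unpair.2 ∈ relCE p.unpair.1 Y} (turingJump Y) := by
  simp only [mem_relCE_iff]
  exact (refl _).preimage_primrec (primrec_compIdx.comp (Primrec.fst.comp Primrec.unpair)
    (primrec_constIdx.comp (Primrec.snd.comp Primrec.unpair)))

theorem exists_jump (hA : SetTuringReducible A Y) :
    SetTuringReducible {a | ∃ n, Nat.pair a n ∈ A} (turingJump Y) := by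
  classical
  -- Unbounded search looks for zeros, and the characteristic function of the complement vanishes
  -- exactly on `A`.
  obtain ⟨c, hc⟩ := exists_code.1 (RecursiveIn.iff_nat.1 hA.compl)
  have h := (relCE_jump Y).preimage_primrec
    (Primrec₂.natPair.comp (Primrec.const (encodeCode (rfind c))) Primrec.id)
  convert h using 1
  ext a
  have := dom_eval_rfind_of_total (g := charFn Y) (c := c)
    (f := fun n => if n ∈ Aᶜ then 1 else 0) (fun n => by rw [hc]; simp [charFn]) a
  simp [relCE, ofNatCode_encodeCode, this]

theorem forall_jump (hA : SetTuringReducible A Y) :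
    SetTuringReducible {a | ∀ n, Nat.pair a n ∈ A} (turingJump Y) := by
  convert hA.compl.exists_jump.compl using 1
  ext a
  simp

theorem jump (hA : SetTuringReducible A Y) : SetTuringReducible A (turingJump Y) := by
  -- A dummy existential quantifier is added.
  simpa using (hA.preimage_primrec (Primrec.fst.comp Primrec.unpair)).exists_jump

end SetTuringReducible

/-! ### Values of programs and indices of computable sets -/

/-- The relation "the program numbered `p.1` computes `v` on input `p.2`, with oracle `X`". -/
def valueSet (v : ℕ) (X : Set ℕ) : Set ℕ :=
  {p | v ∈ eval (charFn X) (ofNatCode p.unpair.1) p.unpair.2}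

/-- The set of inputs on which a given program takes a given value is computably enumerable,
uniformly in the program. -/
theorem exists_primrec_valueIdx (v : ℕ) (X : Set ℕ) : ∃ r : ℕ → ℕ, Primrec r ∧
    ∀ d x, x ∈ relCE (r d) X ↔ v ∈ eval (charFn X) (ofNatCode d) x := by
  have ht : Nat.RecursiveIn {charFn X} fun n => Part.some (if n = v then 0 else 1) :=
    computableIn_nat.1 (Primrec.ite (Primrec.eq.comp Primrec.id (Primrec.const v))
      (Primrec.const 0) (Primrec.const 1)).computableIn
  obtain ⟨c, hc⟩ := exists_code.1 ht
  -- The code number 2 is `left`, which discards the search counter; `c` then returns 0 exactly when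
  -- the value is `v`.
  refine ⟨fun d => rfindIdx (compIdx (encodeCode c) (compIdx d 2)),
    primrec_rfindIdx.comp (primrec_compIdx.comp (Primrec.const _)
      (primrec_compIdx.comp Primrec.id (Primrec.const 2))), fun d x => ?_⟩
  have h := dom_eval_rfind_of_const (g := charFn X) (a := x)
    (c := comp c (comp (ofNatCode d) left))
    (h := eval (charFn X) (ofNatCode d) x >>= fun n => Part.some (if n = v then 0 else 1))
    (fun n => by
      have : eval (charFn X) left (Nat.pair x n) = Part.some x := by simp [eval]
      rw [← eval_comp_of_eq (c := ofNatCode d) this, ← hc]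
      rfl)
  simp [relCE, ofNatCode_encodeCode, ofNatCode, h]

theorem valueSet_le_jump (v : ℕ) (X : Set ℕ) : SetTuringReducible (valueSet v X) (turingJump X) := by
  obtain ⟨r, hr, h⟩ := exists_primrec_valueIdx v X
  have := (SetTuringReducible.relCE_jump X).preimage_primrec (Primrec₂.natPair.comp
    (hr.comp (Primrec.fst.comp Primrec.unpair)) (Primrec.snd.comp Primrec.unpair))
  simpa [h, valueSet] using this

theorem one_mem_charFn {X : Set ℕ} {x : ℕ} : 1 ∈ charFn X x ↔ x ∈ X := by
  by_cases h : x ∈ X <;> simp [charFn, h]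

theorem zero_mem_charFn {X : Set ℕ} {x : ℕ} : 0 ∈ charFn X x ↔ x ∉ X := by
  by_cases h : x ∈ X <;> simp [charFn, h]

/-- This exposes the logical complexity of "a program decides `X`": one universal quantifier over
conditions on single values, with totality included. -/
theorem eq_charFn_iff {X : Set ℕ} {g : ℕ →. ℕ} :
    g = charFn X ↔ ∀ x, (x ∈ X ∧ 1 ∈ g x) ∨ (x ∉ X ∧ 0 ∈ g x) := by
  constructor
  · rintro rfl x
    by_cases h : x ∈ X <;> simp [one_mem_charFn, zero_mem_charFn, h]
  · intro H
    funext x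
    rcases H x with ⟨hx, h⟩ | ⟨hx, h⟩ <;> simpa [charFn, hx] using Part.eq_some_iff.2 h

theorem IsComputableSet.exists_index {A : Set ℕ} (hA : IsComputableSet A) (X : Set ℕ) :
    ∃ d, eval (charFn X) (ofNatCode d) = charFn A := by
  obtain ⟨c, hc⟩ := exists_code.1
    (RecursiveIn.iff_nat.1 (SetTuringReducible.of_computable (Y := X) hA))
  exact ⟨encodeCode c, by rw [ofNatCode_encodeCode, hc]⟩

theorem relCE_substIdx {d e : ℕ} {A X : Set ℕ} (hd : eval (charFn X) (ofNatCode d) = charFn A) :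
    relCE (substIdx d e) X = relCE e A := by
  simp only [relCE, eval_substIdx, hd]

/-! ### Initial segments of columns -/

theorem columnsLT_zero (C : Set ℕ) : columnsLT C 0 = ∅ := by
  simp [columnsLT]

theorem columnsLT_succ (C : Set ℕ) (n : ℕ) : columnsLT C (n + 1) = columnsLE C n := by
  simp [columnsLT, columnsLE]

theorem mem_columnsLE_iff {C : Set ℕ} {n x : ℕ} :
    x ∈ columnsLE C n ↔ x ∈ columnsLT C n ∨ (x.unpair.1 = n ∧ x.unpair.2 ∈ column C n) := by
  have h : x.unpair.1 = n → Nat.pair n x.unpair.2 = x := by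
    rintro rfl
    exact Nat.pair_unpair x
  simp only [columnsLE, columnsLT, column, Set.mem_ofPred_eq, le_iff_lt_or_eq]
  grind

theorem columnsLE_le (C : Set ℕ) (n : ℕ) : SetTuringReducible (columnsLE C n) C :=
  (SetTuringReducible.refl C).inter (SetTuringReducible.of_primrecPred
    (Primrec.nat_le.comp (Primrec.fst.comp Primrec.unpair) (Primrec.const n)))

/-- If the earlier columns form a computable set, adding a column that is computably enumerable in
them yields a set reducible to the halting problem. -/
theorem columnsLE_le_jump {C : Set ℕ} {n e : ℕ} (hA : IsComputableSet (columnsLT C n))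
    (he : column C n = relCE e (columnsLT C n)) :
    SetTuringReducible (columnsLE C n) (turingJump ∅) := by
  obtain ⟨d, hd⟩ := hA.exists_index ∅
  have h₁ : SetTuringReducible {x | x.unpair.1 = n} (turingJump ∅) :=
    SetTuringReducible.of_primrecPred
      (Primrec.eq.comp (Primrec.fst.comp Primrec.unpair) (Primrec.const n))
  have h₂ := (SetTuringReducible.relCE_jump ∅).preimage_primrec (Primrec₂.natPair.comp
    (Primrec.const (substIdx d e)) (Primrec.snd.comp Primrec.unpair))
  convert (SetTuringReducible.of_computable hA).union (h₁.inter h₂) using 1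
  ext x
  rw [mem_columnsLE_iff]
  simp [he, relCE_substIdx hd]

/-! ### Finding decision programs with the double jump -/

/-- `IsNextIndex f n d d'` says that the program `d'` computes the characteristic function of the
set obtained from the set decided by `d` by adding as `n`-th column the set computably enumerable
in it with index `f n`. -/
def IsNextIndex (f : ℕ → ℕ) (n d d' : ℕ) : Prop :=
  eval (charFn ∅) (ofNatCode d') = charFn {x | 1 ∈ eval (charFn ∅) (ofNatCode d) x ∨
    (x.unpair.1 = n ∧ x.unpair.2 ∈ relCE (substIdx d (f n)) ∅)}

/-- `IsNextIndex` mentions only `f` and code numbers, never `C`, so that its complexity can be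
bounded; along correct indices it nevertheless describes the columns of `C`. -/
theorem isNextIndex_iff {f : ℕ → ℕ} {C : Set ℕ} {n d d' : ℕ}
    (hf : column C n = relCE (f n) (columnsLT C n))
    (hd : eval (charFn ∅) (ofNatCode d) = charFn (columnsLT C n)) :
    IsNextIndex f n d d' ↔ eval (charFn ∅) (ofNatCode d') = charFn (columnsLT C (n + 1)) := by
  have : {x | 1 ∈ eval (charFn ∅) (ofNatCode d) x ∨
      (x.unpair.1 = n ∧ x.unpair.2 ∈ relCE (substIdx d (f n)) ∅)} = columnsLT C (n + 1) := by
    ext x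
    rw [columnsLT_succ, mem_columnsLE_iff, relCE_substIdx hd, hd, ← hf]
    simp [one_mem_charFn]
  rw [IsNextIndex, this]

theorem isNextIndex_le {f : ℕ → ℕ} (hf : Computable f) :
    SetTuringReducible {p | IsNextIndex f p.unpair.1.unpair.1 p.unpair.1.unpair.2 p.unpair.2}
      (turingJump (turingJump ∅)) := by
  have u₁ : Primrec fun p : ℕ => p.unpair.1 := Primrec.fst.comp Primrec.unpair
  have u₂ : Primrec fun p : ℕ => p.unpair.2 := Primrec.snd.comp Primrec.unpair
  -- Here `p` codes `⟨⟨⟨n, d⟩, d'⟩, x⟩`, where `x` is the input to be quantified universally.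
  have hn : Primrec fun p : ℕ => p.unpair.1.unpair.1.unpair.1 := u₁.comp (u₁.comp u₁)
  have hd : Primrec fun p : ℕ => p.unpair.1.unpair.1.unpair.2 := u₂.comp (u₁.comp u₁)
  have hd' : Primrec fun p : ℕ => p.unpair.1.unpair.2 := u₂.comp u₁
  have a₁ := (valueSet_le_jump 1 ∅).preimage_primrec (Primrec₂.natPair.comp hd u₂)
  have a₂ : SetTuringReducible {p | p.unpair.2.unpair.1 = p.unpair.1.unpair.1.unpair.1}
      (turingJump ∅) :=
    SetTuringReducible.of_primrecPred (Primrec.eq.comp (u₁.comp u₂) hn)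
  have a₃ := (SetTuringReducible.relCE_jump ∅).preimage
    (Primrec₂.natPair.to_comp.comp (primrec_substIdx.to_comp.comp hd.to_comp
      (hf.comp hn.to_comp)) (u₂.comp u₂).to_comp).computableIn
  have a := a₁.union (a₂.inter a₃)
  have b₁ := (valueSet_le_jump 1 ∅).preimage_primrec (Primrec₂.natPair.comp hd' u₂)
  have b₀ := (valueSet_le_jump 0 ∅).preimage_primrec (Primrec₂.natPair.comp hd' u₂)
  convert ((a.inter b₁).union (a.compl.inter b₀)).forall_jump using 1
  ext p
  rw [Set.mem_ofPred_eq, IsNextIndex, eq_charFn_iff]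
  simp [valueSet]

/-- If every initial segment of columns of an REA[ω] set is computable, then `0''` computes
programs deciding them. -/
theorem exists_computableIn_index {C : Set ℕ} {f : ℕ → ℕ} (hf : Computable f)
    (hC : ∀ n, column C n = relCE (f n) (columnsLT C n))
    (hc : ∀ n, IsComputableSet (columnsLE C n)) :
    ∃ D : ℕ → ℕ, ComputableIn {charFn (turingJump (turingJump ∅))} D ∧
      ∀ n, eval (charFn ∅) (ofNatCode (D n)) = charFn (columnsLT C n) := by
  set O : Set (ℕ →. ℕ) := {charFn (turingJump (turingJump ∅))}
  -- The complement appears because the search looks for a zero.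
  have hstep := (RecursiveIn.iff_nat.1 (isNextIndex_le hf).compl).rfind
  set step : ℕ →. ℕ := fun a => Nat.rfind fun n => (fun m => decide (m = 0)) <$> charFn
    {p | IsNextIndex f p.unpair.1.unpair.1 p.unpair.1.unpair.2 p.unpair.2}ᶜ (Nat.pair a n)
    with step_def
  have step_spec (n d : ℕ) (h : ∃ d', IsNextIndex f n d d') :
      ∃ d' ∈ step (Nat.pair n d), IsNextIndex f n d d' := by
    have hdom : (step (Nat.pair n d)).Dom := by
      obtain ⟨d', h'⟩ := h
      exact Nat.rfind_dom.2 ⟨d', by simpa [zero_mem_charFn] using h',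
        fun {m} _ => by simp [charFn]⟩
    refine ⟨_, Part.get_mem hdom, ?_⟩
    have := Nat.rfind_spec (Part.get_mem hdom)
    simpa [zero_mem_charFn] using this
  -- The start 0 is the code of the zero program, which decides the empty set. The recursion is
  -- partial: `step` is known to converge only at correct indices, so convergence and correctness
  -- are proved together in `F_spec`.
  set F : ℕ → Part ℕ := fun n => n.rec (Part.some 0) fun y IH => do
    let i ← IH
    step (Nat.pair y i) with F_def
  have hF : Nat.RecursiveIn O F := by
    -- The recursion scheme carries a parameter, set to 0 here and dropped by `.right`.
    have h := (Nat.RecursiveIn.prec (Nat.RecursiveIn.zero (O := O)) (hstep.comp .right)).comp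
      (computableIn_nat.1 (Primrec₂.natPair.comp (Primrec.const 0) Primrec.id).computableIn)
    refine h.of_eq fun n => ?_
    simp only [Part.bind_eq_bind, Part.bind_some, Nat.unpair_pair, id]
    induction n with
    | zero => rfl
    | succ n ih =>
      change Part.bind _ _ = Part.bind (F n) _
      rw [ih]
      exact congrArg _ (funext fun i => Part.bind_some _ _)
  have F_spec (n : ℕ) :
      ∃ d ∈ F n, eval (charFn ∅) (ofNatCode d) = charFn (columnsLT C n) := by
    induction n with
    | zero =>
      refine ⟨0, Part.mem_some 0, ?_⟩
      rw [columnsLT_zero]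
      funext x
      simp [ofNatCode, eval, charFn]
      rfl
    | succ n ih =>
      obtain ⟨d, hdF, hd⟩ := ih
      have hex : ∃ d', IsNextIndex f n d d' := by
        obtain ⟨d', h'⟩ := (hc n).exists_index ∅
        exact ⟨d', (isNextIndex_iff (hC n) hd).2 (by rw [h', columnsLT_succ])⟩
      obtain ⟨d', h', hd'⟩ := step_spec n d hex
      exact ⟨d', Part.mem_bind hdF h', (isNextIndex_iff (hC n) hd).1 hd'⟩
  choose D hD hD' using F_spec
  exact ⟨D, computableIn_nat.2 (hF.of_eq_tot hD), hD'⟩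

/-! ### The dichotomy and the conclusion -/

theorem exists_columnsLE_le_or_index {C : Set ℕ} (hC : IsREAOmega C) :
    (∃ n : ℕ, ¬ IsComputableSet (columnsLE C n) ∧
        SetTuringReducible (columnsLE C n) (turingJump ∅)) ∨
      ((∃ i j : ℕ → ℕ,
          ComputableIn {charFn (turingJump (turingJump ∅))} i ∧
          ComputableIn {charFn (turingJump (turingJump ∅))} j ∧
          ∀ n, columnsLE C n = ceSet (i n) ∧ (columnsLE C n)ᶜ = ceSet (j n)) ∧
        SetTuringReducible C (turingJump (turingJump ∅))) := by
  classical
  obtain ⟨f, hf, hC⟩ := hC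
  by_cases hex : ∃ n, ¬ IsComputableSet (columnsLE C n)
  · refine .inl ⟨Nat.find hex, Nat.find_spec hex, columnsLE_le_jump ?_ (hC _)⟩
    rcases h : Nat.find hex with _ | n
    · rw [columnsLT_zero]
      exact (Primrec.nat_lt.comp Primrec.id (Primrec.const 0)).computablePred.of_eq fun _ => by simp
    · rw [columnsLT_succ]
      exact not_not.1 (Nat.find_min hex (h ▸ n.lt_succ_self))
  · push Not at hex
    obtain ⟨D, hD, hD'⟩ := exists_computableIn_index hf hC hex
    obtain ⟨r, hr, hr'⟩ := exists_primrec_valueIdx 1 ∅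
    obtain ⟨s, hs, hs'⟩ := exists_primrec_valueIdx 0 ∅
    -- The shift by one passes from columns below `n` to columns up to `n`. Inputs with output 1
    -- enumerate the set, and inputs with output 0 its complement.
    have hDs := hD.natComp Primrec.succ.computableIn
    refine .inr ⟨⟨fun n => r (D (n + 1)), fun n => s (D (n + 1)), hr.computableIn.natComp hDs,
      hs.computableIn.natComp hDs, fun n => ⟨?_, ?_⟩⟩, ?_⟩
    · ext x
      rw [ceSet, hr', hD', one_mem_charFn, columnsLT_succ]
    · ext x
      rw [ceSet, hs', hD', zero_mem_charFn, columnsLT_succ, Set.mem_compl_iff]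
    -- Membership of `x` in `C` is decided by the program for the columns up to that of `x`.
    · have h := (valueSet_le_jump 1 ∅).jump.preimage
        ((hDs.natComp (Primrec.fst.comp Primrec.unpair).computableIn).natPair
          (ComputableIn.id (α := ℕ)))
      convert h using 1
      ext x
      simp [valueSet, hD', one_mem_charFn, columnsLT]

theorem proposition2 (C : Set ℕ) (hC : IsREAOmega C) (hnc : ¬ IsComputableSet C) :
    ¬ IsMinimalPair C (turingJump (turingJump ∅)) ∧
    (∃ B : Set ℕ, ¬ IsComputableSet B ∧ SetTuringReducible B C ∧
      SetTuringReducible B (turingJump (turingJump ∅))) ∧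
    ((∃ n : ℕ, ¬ IsComputableSet (columnsLE C n) ∧
        SetTuringReducible (columnsLE C n) (turingJump ∅)) ∨
      ((∃ i j : ℕ → ℕ,
          ComputableIn {charFn (turingJump (turingJump ∅))} i ∧
          ComputableIn {charFn (turingJump (turingJump ∅))} j ∧
          ∀ n, columnsLE C n = ceSet (i n) ∧ (columnsLE C n)ᶜ = ceSet (j n)) ∧
        SetTuringReducible C (turingJump (turingJump ∅)))) := by
  have hmain := exists_columnsLE_le_or_index hC
  have hB : ∃ B : Set ℕ, ¬ IsComputableSet B ∧ SetTuringReducible B C ∧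
      SetTuringReducible B (turingJump (turingJump ∅)) := by
    rcases hmain with ⟨n, hn, hle⟩ | ⟨-, hle⟩
    · exact ⟨_, hn, columnsLE_le C n, hle.jump⟩
    · exact ⟨C, hnc, .refl C, hle⟩
  refine ⟨fun hmin => ?_, hB, hmain⟩
  obtain ⟨B, hBc, hB₁, hB₂⟩ := hB
  exact hBc (hmin.2.2 B hB₁ hB₂)
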